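/- \textbf{Conventions.} A query search problem is a relation $R\subseteq\{0,1\}^{m}\times\mathcal O$; $m$ is its number of input bits. For a sequence $(R_n)$, where $R_n$ has $m_n$ input bits (e.g. $m_n=n$), ``polylogarithmic'' means bounded by $c(\log m_n)^c+c$ for a constant $c$. The sequence $R=(R_n)$ belongs to $\mathsf{TF}\Sigma_2^{dt}$ if every $R_n$ is total (each input has a solution) and there are a polylogarithmic witness length $\ell_n$ and, for every output $o$ and $z\in\{0,1\}^{\ell_n}$, a decision tree $V_{o,z}$ of polylogarithmic depth with $R_n(x,o)\iff\forall z\in\{0,1\}^{\ell_n}\;V_{o,z}(x)=1$. Such a presentation gives the unsatisfiable collection $F_{R_n}$ of DNFs $D_o=\bigvee_z\neg V_{o,z}$, one for each output $o$, where $\neg V_{o,z}$ is the disjunction of the terms of the rejecting paths of $V_{o,z}$. A conjunct $t$ is identified with the polynomial $\prod_{x_i\in t}x_i\prod_{\neg x_i\in t}(1-x_i)$, whose degree is its number of literals; the DNF $D_o$ is identified with $\sum_{t\in D_o}t-1$ (terms counted with multiplicity), and a conical junta is a finite sum of conjuncts; the degree of a DNF or of a conical junta is the maximal degree of its conjuncts.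 A Sherali--Adams refutation of $F_{R_n}$ consists of conical juntas $J_o$ (only finitely many nonzero) and $J$ with $\sum_o D_oJ_o+J=-1$ modulo the relations $x_i^2=x_i$. Its degree is the maximum of the degrees of $J$ and of the products $D_oJ_o$, counted as $\deg D_o+\deg J_o$. A formulation of $Q\subseteq\{0,1\}^{k}\times\mathcal O_Q$ by $S\subseteq\{0,1\}^{m}\times\mathcal O_S$ consists of functions $f_i:\{0,1\}^k\to\{0,1\}$ $(i\in[m])$ and $g_o:\{0,1\}^k\to\mathcal O_Q$ $(o\in\mathcal O_S)$ with $S(f(x),o)\Rightarrow Q(x,g_o(x))$ for all $x,o$. Its complexity is $\log m$ plus the least $d$ such that all $f_i$ and $g_o$ are computed by decision trees of depth at most $d$. We write $Q\le_{dt}R$ for sequences if for every $n$ there is an $m$ such that $Q_n$ has an $R_m$-formulation whose complexity is polylogarithmic in the number of input bits of $Q_n$. $\mathsf{LOP}$ is the sequence whose $n$-th problem is: given the $2^n\cdot 2^n$ bits of a relation $\prec$ on $[2^n]$, output either an $x$ such that $x\prec y$ for every $y\ne x$, or a violation of the axioms of a strict linear order, that is, $x$ with $x\prec x$; or $x\neq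 y$ with $x\prec y$ and $y\prec x$; or $x\ne y$ with $x\not\prec y$ and $y\not\prec x$; or distinct $x,y,z$ with $x\prec y$, $y\prec z$ and $x\not\prec z$. \textbf{Corollary.} Suppose that $R\in\mathsf{TF}\Sigma_2^{dt}$ and that, for a presentation as above, the formulas $F_{R_n}$ have Sherali--Adams refutations of polylogarithmic degree. Then $\mathsf{LOP}\not\le_{dt}R$. -/

import Mathlib

/-! ### Polylogarithmic bounds -/

/-- `p(k) = polylog(k)`, i.e. `p(k) ≤ c (log k)^c + c` for some constant `c`. -/
def IsPolylog (p : ℕ → ℕ) : Prop :=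
  ∃ c : ℕ, ∀ k : ℕ, p k ≤ c * Nat.log 2 k ^ c + c

/-! ### Decision trees over `n` input bits -/

/-- Decision trees querying input bits `x i`, `i : Fin n`, with leaves labelled in `α`.
`query i t₀ t₁` continues with `t₀` if `x i = 0` and with `t₁` if `x i = 1`. -/
inductive DTree (n : ℕ) (α : Type) : Type
  | leaf (a : α) : DTree n α
  | query (i : Fin n) (t₀ t₁ : DTree n α) : DTree n α

namespace DTree

variable {n : ℕ} {α : Type}

def eval : DTree n α → (Fin n → Bool) → α
  | leaf a, _ => a
  | query i t₀ t₁, x => if x i then t₁.eval x else t₀.eval x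

def depth : DTree n α → ℕ
  | leaf _ => 0
  | query _ t₀ t₁ => max t₀.depth t₁.depth + 1

end DTree

/-- Some decision tree of depth at most `d` computes `f`, i.e. `depth(f) ≤ d`. -/
def DTDepthLE {n : ℕ} {α : Type} (f : (Fin n → Bool) → α) (d : ℕ) : Prop :=
  ∃ T : DTree n α, T.depth ≤ d ∧ ∀ x, T.eval x = f x

/-! ### Conjuncts, DNFs, conical juntas and their polynomials -/

/-- A conjunct `⋀_{i ∈ pos} x_i ∧ ⋀_{i ∈ neg} ¬ x_i`. -/
structure Conjunct (n : ℕ) where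
  pos : Finset (Fin n)
  neg : Finset (Fin n)

namespace Conjunct

variable {n : ℕ}

/-- The polynomial `∏_{i ∈ pos} x_i ∏_{i ∈ neg} (1 - x_i)` of a conjunct. -/
noncomputable def poly (t : Conjunct n) : MvPolynomial (Fin n) ℝ :=
  (∏ i ∈ t.pos, MvPolynomial.X i) * ∏ i ∈ t.neg, (1 - MvPolynomial.X i)

/-- The degree of a conjunct: its number of literals. -/
def degree (t : Conjunct n) : ℕ := t.pos.card + t.neg.card

/-- The conjunct `x_i ∧ t`. -/
def addPos (i : Fin n) (t : Conjunct n) : Conjunct n := ⟨insert i t.pos, t.neg⟩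

/-- The conjunct `¬ x_i ∧ t`. -/
def addNeg (i : Fin n) (t : Conjunct n) : Conjunct n := ⟨t.pos, insert i t.neg⟩

end Conjunct

/-- A finite collection of conjuncts with multiplicity. It is read either as a DNF (their
disjunction) or as a conical junta (their sum). -/
abbrev Conjuncts (n : ℕ) : Type := Multiset (Conjunct n)

namespace Conjuncts

variable {n : ℕ}

/-- The polynomial `∑ t` of a conical junta. -/
noncomputable def juntaPoly (J : Conjuncts n) : MvPolynomial (Fin n) ℝ :=
  (J.map Conjunct.poly).sum

/-- The polynomial `∑_{t ∈ D} t - 1` of a DNF `D`; it is nonnegative at a Boolean point iff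
`D` is true there. -/
noncomputable def dnfPoly (D : Conjuncts n) : MvPolynomial (Fin n) ℝ :=
  D.juntaPoly - 1

/-- The degree of a DNF, or of a conical junta: the maximal degree of its conjuncts. -/
def degree (D : Conjuncts n) : ℕ := (D.map Conjunct.degree).sup

end Conjuncts

/-- The terms of the paths of a `0/1`-labelled decision tree that end in a leaf labelled
`b`. -/
def DTree.pathTerms {n : ℕ} (b : Bool) : DTree n Bool → Conjuncts n
  | .leaf a => if a = b then {⟨∅, ∅⟩} else 0
  | .query i t₀ t₁ =>
      (t₀.pathTerms b).map (Conjunct.addNeg i) + (t₁.pathTerms b).map (Conjunct.addPos i)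

/-! ### Sherali–Adams refutations -/

/-- The ideal generated by the polynomials `x_i ^ 2 - x_i`. -/
noncomputable def booleanIdeal (n : ℕ) : Ideal (MvPolynomial (Fin n) ℝ) :=
  Ideal.span (Set.range fun i : Fin n =>
    (MvPolynomial.X i : MvPolynomial (Fin n) ℝ) ^ 2 - MvPolynomial.X i)

/-- A Sherali–Adams refutation of a collection of DNFs `D_i`, `i : ι`: conical juntas `J_i`
(for the finitely many indices `i` in `S`; the others are zero) and `J` such that
`∑_i D_i J_i + J = -1` in multilinear arithmetic, i.e. modulo `x_i ^ 2 = x_i`. -/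
structure SARefutation {n : ℕ} {ι : Type} (D : ι → Conjuncts n) where
  S : Finset ι
  Jₐ : ι → Conjuncts n
  J : Conjuncts n
  identity :
    Ideal.Quotient.mk (booleanIdeal n)
      (∑ i ∈ S, (D i).dnfPoly * (Jₐ i).juntaPoly + J.juntaPoly) = -1

/-- The degree of the refutation is at most `d`: the axioms used, the products `D_i J_i`
(as products of the axiom with the conjuncts of the junta), and the junta `J` have degree at
most `d`. -/
def SARefutation.DegreeLE {n : ℕ} {ι : Type} {D : ι → Conjuncts n} (P : SARefutation D)
    (d : ℕ) : Prop :=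
  (∀ i ∈ P.S, (D i).degree + (P.Jₐ i).degree ≤ d) ∧ P.J.degree ≤ d

/-! ### Query search problems -/

/-- A single query search problem, a relation `Rel ⊆ {0,1}^bits × Out`. -/
structure SearchProblem where
  bits : ℕ
  Out : Type
  Rel : (Fin bits → Bool) → Out → Prop

/-- Every input has a solution. -/
def SearchProblem.Total (R : SearchProblem) : Prop :=
  ∀ x, ∃ o, R.Rel x o

/-- A `Σ₂` presentation of a search problem: decision trees `V o z`, for each output `o` and
each witness `z ∈ {0,1}^len`, such that `R(x,o) ↔ ∀ z, V_{o,z}(x) = 1`. -/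
structure Sigma2Presentation (R : SearchProblem) where
  len : ℕ
  V : R.Out → (Fin len → Bool) → DTree R.bits Bool
  spec : ∀ x o, R.Rel x o ↔ ∀ z, (V o z).eval x = true

/-- The collection of DNFs `⋁_z ¬V_{o,z}`, one for each output `o`, expressing that no output
is a solution. Here `¬V_{o,z}` is written as the disjunction of the terms of the rejecting
paths of the decision tree `V_{o,z}`. -/
def Sigma2Presentation.formula {R : SearchProblem} (P : Sigma2Presentation R) :
    R.Out → Conjuncts R.bits :=
  fun o => ∑ z : Fin P.len → Bool, (P.V o z).pathTerms false

/-- The sequence `R` is in `TFΣ₂^dt`, as witnessed by the presentations `P n` of `R n`: it is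
total, and the witness lengths and the depths of the decision trees are polylogarithmic in
the number of input bits. -/
structure IsTFSigma2 (R : ℕ → SearchProblem) (P : ∀ n, Sigma2Presentation (R n)) :
    Prop where
  total : ∀ n, (R n).Total
  len_polylog : ∃ p, IsPolylog p ∧ ∀ n, (P n).len ≤ p (R n).bits
  depth_polylog : ∃ p, IsPolylog p ∧ ∀ n o z, ((P n).V o z).depth ≤ p (R n).bits

/-- The unsatisfiable formulas of the presented sequence have Sherali–Adams refutations of
degree polylogarithmic in the number of input bits. -/
def HasPolylogSARefutation (R : ℕ → SearchProblem) (P : ∀ n, Sigma2Presentation (R n)) :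
    Prop :=
  ∃ p, IsPolylog p ∧ ∀ n, ∃ Q : SARefutation (P n).formula, Q.DegreeLE (p (R n).bits)

/-! ### Decision tree reductions -/

/-- An `S`-formulation of `R`. -/
structure Formulation (R S : SearchProblem) where
  f : Fin S.bits → (Fin R.bits → Bool) → Bool
  g : S.Out → (Fin R.bits → Bool) → R.Out
  correct : ∀ x o, S.Rel (fun i => f i x) o → R.Rel x (g o x)

/-- The complexity of the formulation, the logarithm of its size `S.bits` plus its depth, is
at most `k`. -/
def Formulation.ComplexityLE {R S : SearchProblem} (φ : Formulation R S) (k : ℕ) : Prop :=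
  ∃ d : ℕ, (∀ i, DTDepthLE (φ.f i) d) ∧ (∀ o, DTDepthLE (φ.g o) d) ∧
    Nat.log 2 S.bits + d ≤ k

/-- `R ≤_dt S`: the complexity of reducing `R n` to the sequence `S` (the minimum over `m` of
the complexity of reducing `R n` to `S m`) is polylogarithmic in the number of input bits of
`R n`. -/
def DTReduces (R S : ℕ → SearchProblem) : Prop :=
  ∃ p, IsPolylog p ∧ ∀ n, ∃ m, ∃ φ : Formulation (R n) (S m), φ.ComplexityLE (p (R n).bits)

/-! ### The linear ordering principle -/

/-- Purported solutions of the linear ordering principle on `N` elements: a minimal element,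
or a violation of irreflexivity, asymmetry, totality or transitivity. -/
inductive LOPOut (N : ℕ) : Type
  | minimal (a : Fin N) : LOPOut N
  | irrefl (a : Fin N) : LOPOut N
  | asymm (a b : Fin N) : LOPOut N
  | total (a b : Fin N) : LOPOut N
  | trans (a b c : Fin N) : LOPOut N

/-- When an output is a solution for the relation `≺` given by `r`. -/
def LOPOut.IsSolution {N : ℕ} (r : Fin N → Fin N → Bool) : LOPOut N → Prop
  | .minimal a => ∀ b, b ≠ a → r a b = true
  | .irrefl a => r a a = true
  | .asymm a b => a ≠ b ∧ r a b = true ∧ r b a = true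
  | .total a b => a ≠ b ∧ r a b = false ∧ r b a = false
  | .trans a b c =>
      a ≠ b ∧ b ≠ c ∧ a ≠ c ∧ r a b = true ∧ r b c = true ∧ r a c = false

/-- The linear ordering principle on `N` elements. The input consists of the `N * N` bits
`a ≺ b`. -/
def LOPOn (N : ℕ) : SearchProblem where
  bits := N * N
  Out := LOPOut N
  Rel x o := o.IsSolution fun a b => x (finProdFinEquiv (a, b))

/-- The search problem `LOP`: the `n`-th problem is about relations on `[2^n]`. -/
def LOP : ℕ → SearchProblem := fun n => LOPOn (2 ^ n)

/-! The proof averages the refutation over all linear orders `b ≺ c ↔ π b < π c`, with `π` a uniform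
permutation of `N = 2^n` positions. Given a shallow formulation, substitute its trees `f i` into the
identity `∑ D_o J_o + J = -1`. The average of `J` is nonnegative, so a contradiction follows once
every product of an axiom `D_o` with a conjunct `t` has nonnegative average
(`Formulation.sum_dnfPoly_mul_conjunct_nonneg`).

Such a product is negative only where `o` solves `R`. There `g o` must return a LOP solution, and in
a genuine linear order this can only be the true minimum. Splitting by the element `a` that `g o`
names, each piece is nonnegative at every order in which `a` is not minimal.

Each piece is a combination of functions of the relative order of few elements. Summed over the `π`
with `π a = r`, it is therefore a polynomial of low degree in `r` (`OrderLocal.exists_polynomial`),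
because the ranks of `a` within a small set are counted by products of binomial coefficients. A
polynomial of degree `D` that is nonnegative at `1, …, M` with `M` of order `D²` cannot be so
negative at `0` that its sum over `0, …, M` is negative (`sum_range_eval_nonneg`). Thus `N` is at
most quadratic in depth times degree, which is polynomial in `n`, whereas `N = 2^n`. -/

/-! ### Low-degree polynomials that are nonnegative at positive integers -/

/-- A polynomial of degree less than `2 * L`, nonnegative at all the integers `k - L ≠ 0` with
`k ≤ 2 * L`, has nonnegative sum over these integers and `0`. -/
theorem sum_eval_shift_nonneg (q : Polynomial ℝ) (L : ℕ) (hdeg : q.natDegree < 2 * L)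
    (hq : ∀ k ≤ 2 * L, k ≠ L → 0 ≤ q.eval ((k : ℝ) - L)) :
    0 ≤ ∑ k ∈ Finset.range (2 * L + 1), q.eval ((k : ℝ) - L) := by
  have h0 := congrFun (Polynomial.fwdDiff_iter_eq_zero_of_degree_lt hdeg) (-(L : ℝ))
  rw [fwdDiff_iter_eq_sum_shift] at h0
  have hC : (0 : ℝ) < ((2 * L).choose L : ℕ) := by
    exact_mod_cast Nat.choose_pos (by omega)
  -- Scale by the central binomial coefficient and subtract the vanishing `2L`-th difference, with
  -- its sign chosen so that the centre has sign `+`. The uncontrolled value at `k = L` then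
  -- cancels, and all other coefficients are nonnegative because the central coefficient is the
  -- largest.
  refine nonneg_of_mul_nonneg_right (b := _) ?_ hC
  rw [Finset.mul_sum]
  have h1 : ∑ k ∈ Finset.range (2 * L + 1),
      ((-1 : ℝ) ^ (k + L) * ((2 * L).choose k : ℕ)) * q.eval ((k : ℝ) - L) = 0 := by
    have h2 : ∑ k ∈ Finset.range (2 * L + 1),
        ((-1 : ℝ) ^ (k + L) * ((2 * L).choose k : ℕ)) * q.eval ((k : ℝ) - L) =
        (-1) ^ L * ∑ k ∈ Finset.range (2 * L + 1),
          ((-1 : ℤ) ^ (2 * L - k) * (2 * L).choose k) • q.eval (-(L : ℝ) + k • 1) := by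
      rw [Finset.mul_sum]
      refine Finset.sum_congr rfl fun k hk => ?_
      have hk' : k ≤ 2 * L := by simpa [Nat.lt_succ_iff] using hk
      have h3 : (-1 : ℝ) ^ (2 * L - k) = (-1) ^ k := by
        have : (-1 : ℝ) ^ (2 * L - k) * (-1) ^ k = 1 := by
          rw [← pow_add, Nat.sub_add_cancel hk', pow_mul]; simp
        rcases neg_one_pow_eq_or ℝ k with h | h <;> rw [h] at this ⊢ <;> linarith
      have h4 : (-(L : ℝ) + k • (1 : ℝ)) = (k : ℝ) - L := by simp; ring
      rw [h4, zsmul_eq_mul]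
      push_cast
      rw [h3, pow_add]
      ring
    rw [h2, h0]; simp
  rw [← h1]
  refine Finset.sum_le_sum fun k hk => ?_
  have hk' : k ≤ 2 * L := by simpa [Nat.lt_succ_iff] using hk
  by_cases hkL : k = L
  · subst hkL
    rw [← two_mul, pow_mul]
    simp
  · refine mul_le_mul_of_nonneg_right ?_ (hq k hk' hkL)
    have h5 : (((2 * L).choose k : ℕ) : ℝ) ≤ ((2 * L).choose L : ℕ) := by
      exact_mod_cast Nat.choose_le_centralBinom k L
    have h6 : (0 : ℝ) ≤ ((2 * L).choose k : ℕ) := Nat.cast_nonneg _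
    rcases neg_one_pow_eq_or ℝ (k + L) with h | h <;> rw [h] <;> linarith

/-- Substituting `c x²` folds the integers `-L, …, L` onto `0` (once) and the points `c j²` (twice
each). The degree only doubles, which `2L + 1` points can afford. This quadratic spacing is the
source of the square in the final bound. -/
theorem eval_zero_add_two_mul_sum_nonneg (p : Polynomial ℝ) (c L : ℕ) (hdeg : p.natDegree < L)
    (hp : ∀ j < L, 0 ≤ p.eval ((c * (j + 1) ^ 2 : ℕ) : ℝ)) :
    0 ≤ p.eval 0 + 2 * ∑ j ∈ Finset.range L, p.eval ((c * (j + 1) ^ 2 : ℕ) : ℝ) := by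
  set q : Polynomial ℝ := p.comp (Polynomial.C (c : ℝ) * Polynomial.X ^ 2) with hq
  have hqe (x : ℝ) : q.eval x = p.eval (c * x ^ 2) := by simp [hq]
  have hqd : q.natDegree < 2 * L := by
    have h1 : (Polynomial.C (c : ℝ) * Polynomial.X ^ 2).natDegree ≤ 2 :=
      Polynomial.natDegree_C_mul_X_pow_le _ _
    have h2 : q.natDegree ≤ p.natDegree * 2 :=
      Polynomial.natDegree_comp_le.trans (Nat.mul_le_mul_left _ h1)
    omega
  have h1 : ∀ j < L, q.eval (((L + (1 + j) : ℕ) : ℝ) - L) =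
      p.eval ((c * (j + 1) ^ 2 : ℕ) : ℝ) := by
    intro j _
    rw [hqe]; congr 1; push_cast; ring
  have h2 : ∀ j < L, q.eval (((L - 1 - j : ℕ) : ℝ) - L) =
      p.eval ((c * (j + 1) ^ 2 : ℕ) : ℝ) := by
    intro j hj
    have : ((L - 1 - j : ℕ) : ℝ) = L - 1 - j := by
      rw [Nat.sub_sub, Nat.cast_sub (by omega)]; push_cast; ring
    rw [hqe, this]; congr 1; push_cast; ring
  have key := sum_eval_shift_nonneg q L hqd (by
    intro k hk hkL
    rcases lt_or_gt_of_ne hkL with h | h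
    · have := h2 (L - 1 - k) (by omega)
      rw [show L - 1 - (L - 1 - k) = k by omega] at this
      rw [this]; exact hp _ (by omega)
    · have := h1 (k - L - 1) (by omega)
      rw [show L + (1 + (k - L - 1)) = k by omega] at this
      rw [this]; exact hp _ (by omega))
  rw [show 2 * L + 1 = L + (1 + L) by ring, Finset.sum_range_add, Finset.sum_range_add,
    ← Finset.sum_range_reflect, Finset.sum_congr rfl fun j hj => h2 j (Finset.mem_range.1 hj),
    Finset.sum_congr rfl fun j hj => h1 j (Finset.mem_range.1 hj)] at key
  simp only [Finset.sum_range_one, add_zero, sub_self, hqe] at key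
  norm_num at key
  push_cast
  linarith

theorem sq_ne_two_mul_sq (a b : ℕ) (hb : b ≠ 0) : a ^ 2 ≠ 2 * b ^ 2 := by
  intro h
  obtain ⟨c, rfl⟩ : b ∣ a := (Nat.pow_dvd_pow_iff two_ne_zero).1 ⟨2, by rw [h]; ring⟩
  have h1 : b ^ 2 * c ^ 2 = b ^ 2 * 2 := by rw [← mul_pow, h]; ring
  have h2 : c ^ 2 = 2 := Nat.eq_of_mul_eq_mul_left (by positivity) h1
  rcases Nat.lt_or_ge c 2 with hc | hc
  · interval_cases c <;> omega
  · nlinarith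

/-- A polynomial of degree at most `D` that is nonnegative at `1, …, M`, where
`M ≥ 2 (D + 1)²`, has nonnegative sum over `0, …, M`. -/
theorem sum_range_eval_nonneg (p : Polynomial ℝ) (D M : ℕ) (hdeg : p.natDegree ≤ D)
    (hM : 2 * (D + 1) ^ 2 ≤ M) (hp : ∀ r, 1 ≤ r → r ≤ M → 0 ≤ p.eval (r : ℝ)) :
    0 ≤ ∑ r ∈ Finset.range (M + 1), p.eval (r : ℝ) := by
  have hle : ∀ j < D + 1, (j + 1) ^ 2 ≤ (D + 1) ^ 2 := fun j hj => by gcongr; omega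
  have hpos : ∀ j, 1 ≤ (j + 1) ^ 2 := fun j => Nat.one_le_pow _ _ (by omega)
  have h1 := eval_zero_add_two_mul_sum_nonneg p 1 (D + 1) (by omega) (fun j hj =>
    hp _ (by have := hpos j; omega) (by have := hle j hj; omega))
  have h2 := eval_zero_add_two_mul_sum_nonneg p 2 (D + 1) (by omega) (fun j hj =>
    hp _ (by have := hpos j; omega) (by have := hle j hj; omega))
  -- The weight of `0` is half that of the other points in a single instance. Adding the instances
  -- `c = 1` and `c = 2` equalises the weights, provided the two point sets are disjoint, which is
  -- the irrationality of `√2`. Points outside both sets only help.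
  set A := (Finset.range (D + 1)).image fun j => 1 * (j + 1) ^ 2 with hA
  set B := (Finset.range (D + 1)).image fun j => 2 * (j + 1) ^ 2 with hB
  have hinj (c : ℕ) (hc : 0 < c) : Function.Injective fun j : ℕ => c * (j + 1) ^ 2 := by
    intro i j hij
    have h := Nat.eq_of_mul_eq_mul_left hc hij
    have := Nat.pow_left_injective two_ne_zero h
    omega
  have hAB : Disjoint A B := by
    rw [Finset.disjoint_left]
    intro x hxA hxB
    obtain ⟨i, -, rfl⟩ := Finset.mem_image.1 hxA
    obtain ⟨j, -, hj⟩ := Finset.mem_image.1 hxB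
    exact sq_ne_two_mul_sq (i + 1) (j + 1) (by omega) (by omega)
  have h3 : ∑ r ∈ A ∪ B, p.eval (r : ℝ) ≤ ∑ r ∈ Finset.Icc 1 M, p.eval (r : ℝ) := by
    refine Finset.sum_le_sum_of_subset_of_nonneg ?_ fun r hr _ => ?_
    · intro x hx
      rw [Finset.mem_Icc]
      rcases Finset.mem_union.1 hx with hx | hx <;> obtain ⟨j, hj, rfl⟩ := Finset.mem_image.1 hx <;>
        have := hle j (Finset.mem_range.1 hj) <;> have := hpos j <;> omega
    · exact hp r (Finset.mem_Icc.1 hr).1 (Finset.mem_Icc.1 hr).2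
  rw [Finset.sum_union hAB, hA, hB, Finset.sum_image fun i _ j _ h => hinj 1 one_pos h,
    Finset.sum_image fun i _ j _ h => hinj 2 two_pos h] at h3
  rw [Finset.range_eq_Ico, Finset.sum_eq_sum_Ico_succ_bot (by omega)]
  have h4 : Finset.Ico (0 + 1) (M + 1) = Finset.Icc 1 M := by ext; simp
  rw [h4]
  push_cast at *
  linarith

/-! ### Functions of the relative order of a few elements -/

/-- `F` depends only on the order that the positions `π b` induce on the elements `b` of `U`. -/
def OrderLocal {N : ℕ} (U : Finset (Fin N)) (F : Equiv.Perm (Fin N) → ℝ) : Prop :=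
  ∀ π π' : Equiv.Perm (Fin N), (∀ b ∈ U, ∀ c ∈ U, π b < π c ↔ π' b < π' c) → F π = F π'

theorem OrderLocal.mono {N : ℕ} {U U' : Finset (Fin N)} {F : Equiv.Perm (Fin N) → ℝ}
    (hF : OrderLocal U F) (h : U ⊆ U') : OrderLocal U' F :=
  fun π π' hπ => hF π π' fun b hb c hc => hπ b (h hb) c (h hc)

/-- Such a set consists of `r`, of `i` positions below `r` and of `j` positions above it, chosen
independently. -/
theorem card_filter_rank {N : ℕ} (r : Fin N) (i j : ℕ) :
    ((Finset.powersetCard (i + 1 + j) (Finset.univ : Finset (Fin N))).filter fun A =>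
      r ∈ A ∧ (A.filter (· < r)).card = i).card = (r : ℕ).choose i * (N - 1 - r).choose j := by
  have h : ((Finset.Iio r).powersetCard i ×ˢ (Finset.Ioi r).powersetCard j).card =
      (r : ℕ).choose i * (N - 1 - r).choose j := by
    rw [Finset.card_product, Finset.card_powersetCard, Finset.card_powersetCard,
      Fin.card_Iio, Fin.card_Ioi]
  have hsplit (A : Finset (Fin N)) (hr : r ∈ A) :
      insert r (A.filter (· < r) ∪ A.filter (r < ·)) = A := by
    ext x
    simp only [Finset.mem_insert, Finset.mem_union, Finset.mem_filter]
    rcases lt_trichotomy x r with hx | rfl | hx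
    · simp [hx, hx.ne, hx.not_gt]
    · simp [hr]
    · simp [hx, hx.ne', hx.not_gt]
  have hcard (X Y : Finset (Fin N)) (hX : X ⊆ Finset.Iio r) (hY : Y ⊆ Finset.Ioi r) :
      (insert r (X ∪ Y)).card = X.card + 1 + Y.card := by
    have hd : Disjoint X Y := by
      rw [Finset.disjoint_left]
      intro x hx hy
      exact lt_asymm (Finset.mem_Iio.1 (hX hx)) (Finset.mem_Ioi.1 (hY hy))
    rw [Finset.card_insert_of_notMem, Finset.card_union_of_disjoint hd]
    · ring
    · intro hr
      rcases Finset.mem_union.1 hr with hr | hr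
      · exact lt_irrefl _ (Finset.mem_Iio.1 (hX hr))
      · exact lt_irrefl _ (Finset.mem_Ioi.1 (hY hr))
  have hlt (X Y : Finset (Fin N)) (hX : X ⊆ Finset.Iio r) (hY : Y ⊆ Finset.Ioi r) :
      (insert r (X ∪ Y)).filter (· < r) = X := by
    ext x
    simp only [Finset.mem_insert, Finset.mem_union, Finset.mem_filter]
    constructor
    · rintro ⟨rfl | hx | hx, hlt⟩
      · exact absurd hlt (lt_irrefl _)
      · exact hx
      · exact absurd hlt (Finset.mem_Ioi.1 (hY hx)).not_gt
    · exact fun hx => ⟨Or.inr (Or.inl hx), Finset.mem_Iio.1 (hX hx)⟩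
  have hgt (X Y : Finset (Fin N)) (hX : X ⊆ Finset.Iio r) (hY : Y ⊆ Finset.Ioi r) :
      (insert r (X ∪ Y)).filter (r < ·) = Y := by
    ext x
    simp only [Finset.mem_insert, Finset.mem_union, Finset.mem_filter]
    constructor
    · rintro ⟨rfl | hx | hx, hlt⟩
      · exact absurd hlt (lt_irrefl _)
      · exact absurd hlt (Finset.mem_Iio.1 (hX hx)).not_gt
      · exact hx
    · exact fun hx => ⟨Or.inr (Or.inr hx), Finset.mem_Ioi.1 (hY hx)⟩
  have hl (A : Finset (Fin N)) : A.filter (· < r) ⊆ Finset.Iio r := fun x hx =>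
    Finset.mem_Iio.2 (Finset.mem_filter.1 hx).2
  have hg (A : Finset (Fin N)) : A.filter (r < ·) ⊆ Finset.Ioi r := fun x hx =>
    Finset.mem_Ioi.2 (Finset.mem_filter.1 hx).2
  rw [← h]
  refine Finset.card_nbij' (fun A => (A.filter (· < r), A.filter (r < ·)))
    (fun XY => insert r (XY.1 ∪ XY.2)) ?_ ?_ ?_ ?_
  · intro A hA
    simp only [Finset.coe_filter, Set.mem_ofPred_eq, Finset.mem_powersetCard] at hA
    obtain ⟨⟨-, hAc⟩, hr, hi⟩ := hA
    have := hcard _ _ (hl A) (hg A)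
    rw [hsplit A hr] at this
    simp only [Finset.coe_product, Set.mem_prod, Finset.mem_coe, Finset.mem_powersetCard]
    exact ⟨⟨hl A, hi⟩, hg A, by omega⟩
  · rintro ⟨X, Y⟩ hXY
    simp only [Finset.coe_product, Set.mem_prod, Finset.mem_coe, Finset.mem_powersetCard] at hXY
    obtain ⟨⟨hX, hXi⟩, hY, hYj⟩ := hXY
    simp only [Finset.coe_filter, Set.mem_ofPred_eq, Finset.mem_powersetCard]
    refine ⟨⟨Finset.subset_univ _, ?_⟩, Finset.mem_insert_self _ _, ?_⟩
    · rw [hcard X Y hX hY, hXi, hYj]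
    · rw [hlt X Y hX hY, hXi]
  · intro A hA
    simp only [Finset.coe_filter, Set.mem_ofPred_eq] at hA
    exact hsplit A hA.2.1
  · rintro ⟨X, Y⟩ hXY
    simp only [Finset.coe_product, Set.mem_prod, Finset.mem_coe, Finset.mem_powersetCard] at hXY
    simp only [hlt X Y hXY.1.1 hXY.2.1, hgt X Y hXY.1.1 hXY.2.1]

/-- An order isomorphism between two sets of the same size that extends to a permutation. -/
theorem exists_perm_strictMonoOn {N : ℕ} {A A' : Finset (Fin N)} (h : A.card = A'.card) :
    ∃ σ : Equiv.Perm (Fin N), A.map σ.toEmbedding = A' ∧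
      ∀ x ∈ A, ∀ y ∈ A, σ x < σ y ↔ x < y := by
  obtain ⟨σ, hσ⟩ := Equiv.Perm.exists_extending_pair
    (fun i : Fin A.card => A.orderEmbOfFin rfl i) (fun i => A'.orderEmbOfFin h.symm i)
    (A.orderEmbOfFin rfl).injective (A'.orderEmbOfFin h.symm).injective
  have hex : ∀ x ∈ A, ∃ i, A.orderEmbOfFin rfl i = x := fun x hx => by
    have : x ∈ Set.range (A.orderEmbOfFin rfl) := by simpa using hx
    exact this
  refine ⟨σ, Finset.eq_of_subset_of_card_le ?_ (by simp [h]), ?_⟩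
  · intro y hy
    obtain ⟨x, hx, rfl⟩ := Finset.mem_map.1 hy
    obtain ⟨i, rfl⟩ := hex x hx
    simp [hσ i]
  · intro x hx y hy
    obtain ⟨i, rfl⟩ := hex x hx
    obtain ⟨j, rfl⟩ := hex y hy
    rw [hσ i, hσ j]
    simp

theorem eq_of_card_filter_lt_eq {N : ℕ} {A : Finset (Fin N)} {r s : Fin N} (hr : r ∈ A)
    (hs : s ∈ A) (h : (A.filter (· < r)).card = (A.filter (· < s)).card) : r = s := by
  have aux : ∀ r ∈ A, ∀ s, r < s → (A.filter (· < r)).card < (A.filter (· < s)).card := by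
    intro r hr s hrs
    refine Finset.card_lt_card (Finset.ssubset_iff_subset_ne.2 ⟨?_, ?_⟩)
    · intro x hx
      rw [Finset.mem_filter] at hx ⊢
      exact ⟨hx.1, hx.2.trans hrs⟩
    · intro heq
      have : r ∈ A.filter (· < s) := Finset.mem_filter.2 ⟨hr, hrs⟩
      rw [← heq] at this
      exact lt_irrefl _ (Finset.mem_filter.1 this).2
  rcases lt_trichotomy r s with hrs | hrs | hrs
  · exact absurd h (aux r hr s hrs).ne
  · exact hrs
  · exact absurd h (aux s hs r hrs).ne'

/-- Left multiplication by a permutation that is increasing from `A` onto `A'` is a bijection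
between the two fibers. It preserves the order induced on `U`, hence `F`, and equality of ranks
makes it send `r` to `r'`. -/
theorem OrderLocal.sum_fiber_eq {N : ℕ} {U : Finset (Fin N)} {F : Equiv.Perm (Fin N) → ℝ}
    (hF : OrderLocal U F) (a : Fin N) {A A' : Finset (Fin N)} {r r' : Fin N}
    (hA : A.card = A'.card) (hr : r ∈ A) (hr' : r' ∈ A')
    (hrank : (A.filter (· < r)).card = (A'.filter (· < r')).card) :
    ∑ π : Equiv.Perm (Fin N) with π a = r ∧ U.map π.toEmbedding = A, F π =
      ∑ π : Equiv.Perm (Fin N) with π a = r' ∧ U.map π.toEmbedding = A', F π := by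
  obtain ⟨σ, hσA, hσ⟩ := exists_perm_strictMonoOn hA
  have hσr : σ r = r' := by
    refine eq_of_card_filter_lt_eq (A := A') ?_ hr' ?_
    · rw [← hσA]; exact Finset.mem_map_of_mem _ hr
    · rw [← hrank, ← hσA, Finset.filter_map, Finset.card_map]
      congr 1
      refine Finset.filter_congr fun x hx => ?_
      exact hσ x hx r hr
  refine Finset.sum_equiv (Equiv.mulLeft σ) ?_ ?_
  · intro π
    have h1 : U.map (σ * π).toEmbedding = (U.map π.toEmbedding).map σ.toEmbedding := by
      rw [Finset.map_map]; rfl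
    simp only [Finset.mem_filter, Finset.mem_univ, true_and, Equiv.coe_mulLeft, h1,
      Equiv.Perm.mul_apply]
    rw [← hσr, ← hσA, (Finset.map_injective _).eq_iff, σ.injective.eq_iff]
  · intro π hπ
    simp only [Finset.mem_filter, Finset.mem_univ, true_and] at hπ
    refine hF _ _ fun b hb c hc => ?_
    have hm : ∀ b ∈ U, π b ∈ A := fun b hb => by
      rw [← hπ.2]; exact Finset.mem_map_of_mem _ hb
    exact (hσ _ (hm b hb) _ (hm c hc)).symm

theorem OrderLocal.exists_sum_fiber {N : ℕ} {U : Finset (Fin N)}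
    {F : Equiv.Perm (Fin N) → ℝ} (hF : OrderLocal U F) (a : Fin N) :
    ∃ c : ℕ → ℝ, ∀ A : Finset (Fin N), A.card = U.card → ∀ r ∈ A,
      ∑ π : Equiv.Perm (Fin N) with π a = r ∧ U.map π.toEmbedding = A, F π =
        c (A.filter (· < r)).card := by
  classical
  let T := {Ar : Finset (Fin N) × Fin N // Ar.1.card = U.card ∧ Ar.2 ∈ Ar.1}
  let rank : T → ℕ := fun Ar => (Ar.1.1.filter (· < Ar.1.2)).card
  let S : T → ℝ := fun Ar =>
    ∑ π : Equiv.Perm (Fin N) with π a = Ar.1.2 ∧ U.map π.toEmbedding = Ar.1.1, F π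
  have hS : Function.FactorsThrough S rank := fun x y hxy =>
    hF.sum_fiber_eq a (x.2.1.trans y.2.1.symm) x.2.2 y.2.2 hxy
  -- The default `0` is taken only at ranks that no pair `(A, r)` attains.
  refine ⟨Function.extend rank S 0, fun A hA r hr => ?_⟩
  exact (hS.extend_apply 0 ⟨(A, r), hA, hr⟩).symm

theorem exists_polynomial_choose (i : ℕ) :
    ∃ p : Polynomial ℝ, p.natDegree ≤ i ∧ ∀ n : ℕ, p.eval (n : ℝ) = n.choose i := by
  refine ⟨Polynomial.C ((i.factorial : ℝ)⁻¹) * descPochhammer ℝ i, ?_, fun n => ?_⟩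
  · refine (Polynomial.natDegree_C_mul_le _ _).trans ?_
    rw [descPochhammer_natDegree]
  · rw [Polynomial.eval_mul, Polynomial.eval_C, descPochhammer_eval_eq_descFactorial,
      Nat.descFactorial_eq_factorial_mul_choose]
    have : (i.factorial : ℝ) ≠ 0 := by exact_mod_cast i.factorial_ne_zero
    push_cast
    field_simp

theorem exists_polynomial_choose_mul_choose (N i j : ℕ) :
    ∃ p : Polynomial ℝ, p.natDegree ≤ i + j ∧
      ∀ r : Fin N, p.eval ((r : ℕ) : ℝ) = ((r : ℕ).choose i * (N - 1 - r).choose j : ℕ) := by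
  obtain ⟨p, hpd, hp⟩ := exists_polynomial_choose i
  obtain ⟨q, hqd, hq⟩ := exists_polynomial_choose j
  refine ⟨p * q.comp (Polynomial.C ((N : ℝ) - 1) - Polynomial.X), ?_, fun r => ?_⟩
  · refine Polynomial.natDegree_mul_le.trans (add_le_add hpd ?_)
    refine Polynomial.natDegree_comp_le.trans ?_
    have : (Polynomial.C ((N : ℝ) - 1) - Polynomial.X).natDegree ≤ 1 :=
      (Polynomial.natDegree_sub_le _ _).trans
        (max_le ((Polynomial.natDegree_C _).trans_le zero_le_one) Polynomial.natDegree_X_le)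
    nlinarith
  · have : ((N : ℝ) - 1 - (r : ℕ)) = ((N - 1 - r : ℕ) : ℝ) := by
      have := r.2
      rw [Nat.sub_sub, Nat.cast_sub (by omega)]; push_cast; ring
    simp [hp, this, hq]

/-- The sum of an order-local function over the permutations that put `a` at position `r` is
polynomial in `r`. -/
theorem OrderLocal.exists_polynomial {N : ℕ} {U : Finset (Fin N)}
    {F : Equiv.Perm (Fin N) → ℝ} (hF : OrderLocal U F) (a : Fin N) :
    ∃ p : Polynomial ℝ, p.natDegree ≤ U.card ∧
      ∀ r : Fin N, ∑ π : Equiv.Perm (Fin N) with π a = r, F π = p.eval ((r : ℕ) : ℝ) := by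
  classical
  -- Adjoining `a` to `U` does not cost a degree: `a` occupies the position `r` itself, so only the
  -- `u` other positions contribute.
  obtain ⟨V, u, hV, haV, hVc, hu⟩ : ∃ (V : Finset (Fin N)) (u : ℕ), OrderLocal V F ∧ a ∈ V ∧
      V.card = u + 1 ∧ u ≤ U.card := by
    refine ⟨insert a U, (insert a U).card - 1, hF.mono (Finset.subset_insert _ _),
      Finset.mem_insert_self _ _, ?_, ?_⟩
    · have : 0 < (insert a U).card := Finset.card_pos.2 ⟨a, Finset.mem_insert_self _ _⟩
      omega
    · have := Finset.card_insert_le a U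
      omega
  obtain ⟨c, hc⟩ := hV.exists_sum_fiber a
  choose p hpd hp using exists_polynomial_choose_mul_choose N
  -- The index `i` is the rank of `a` within `V`: the fiber sum has the common value `c i`, and
  -- `r.choose i * (N - 1 - r).choose (u - i)` image sets give this rank.
  refine ⟨∑ i ∈ Finset.range (u + 1), Polynomial.C (c i) * p i (u - i), ?_, fun r => ?_⟩
  · refine (Polynomial.natDegree_sum_le_of_forall_le _ _ fun i hi => ?_).trans hu
    refine (Polynomial.natDegree_C_mul_le _ _).trans ((hpd _ _).trans ?_)
    have := Finset.mem_range.1 hi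
    omega
  set S := (Finset.powersetCard (u + 1) (Finset.univ : Finset (Fin N))).filter (r ∈ ·) with hS
  have h1 : ∑ π : Equiv.Perm (Fin N) with π a = r, F π =
      ∑ A ∈ S, ∑ π : Equiv.Perm (Fin N) with π a = r ∧ V.map π.toEmbedding = A, F π := by
    rw [← Finset.sum_fiberwise_of_maps_to (t := S) (g := fun π => V.map π.toEmbedding)]
    · refine Finset.sum_congr rfl fun A _ => ?_
      rw [Finset.filter_filter]
    · intro π hπ
      simp only [Finset.mem_filter, Finset.mem_univ, true_and] at hπ
      rw [hS, Finset.mem_filter, Finset.mem_powersetCard]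
      refine ⟨⟨Finset.subset_univ _, by simpa using hVc⟩, ?_⟩
      rw [← hπ]
      exact Finset.mem_map_of_mem π.toEmbedding haV
  have h2 : ∀ A ∈ S, ∑ π : Equiv.Perm (Fin N) with π a = r ∧ V.map π.toEmbedding = A, F π =
      c (A.filter (· < r)).card := by
    intro A hA
    rw [hS, Finset.mem_filter, Finset.mem_powersetCard] at hA
    exact hc A (hA.1.2.trans hVc.symm) r hA.2
  rw [h1, Finset.sum_congr rfl h2,
    ← Finset.sum_fiberwise_of_maps_to (t := Finset.range (u + 1))
      (g := fun A : Finset (Fin N) => (A.filter (· < r)).card), Polynomial.eval_finsetSum]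
  · refine Finset.sum_congr rfl fun i hi => ?_
    rw [Finset.sum_congr rfl fun A hA => by rw [(Finset.mem_filter.1 hA).2], Finset.sum_const,
      hS, Finset.filter_filter, Polynomial.eval_mul, Polynomial.eval_C, hp,
      ← card_filter_rank, nsmul_eq_mul, mul_comm]
    have := Finset.mem_range.1 hi
    rw [show i + 1 + (u - i) = u + 1 by omega]
  · intro A hA
    rw [hS, Finset.mem_filter, Finset.mem_powersetCard] at hA
    rw [Finset.mem_range, ← hA.1.2]
    refine Finset.card_lt_card (Finset.filter_ssubset.2 ⟨r, hA.2, lt_irrefl _⟩)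

/-! ### The filtration by number of elements inspected -/

/-- The span of the functions that depend on the relative order of at most `q` elements. -/
def orderLocalSpan (N q : ℕ) : Submodule ℝ (Equiv.Perm (Fin N) → ℝ) :=
  Submodule.span ℝ {F | ∃ U : Finset (Fin N), U.card ≤ q ∧ OrderLocal U F}

theorem OrderLocal.mem_orderLocalSpan {N q : ℕ} {U : Finset (Fin N)}
    {F : Equiv.Perm (Fin N) → ℝ} (hF : OrderLocal U F) (hU : U.card ≤ q) :
    F ∈ orderLocalSpan N q :=
  Submodule.subset_span ⟨U, hU, hF⟩

theorem orderLocalSpan_mono {N q q' : ℕ} (h : q ≤ q') :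
    orderLocalSpan N q ≤ orderLocalSpan N q' :=
  Submodule.span_mono fun _ ⟨U, hU, hF⟩ => ⟨U, hU.trans h, hF⟩

theorem const_mem_orderLocalSpan {N q : ℕ} (c : ℝ) : (fun _ => c) ∈ orderLocalSpan N q :=
  OrderLocal.mem_orderLocalSpan (U := ∅) (fun _ _ _ => rfl) (by simp)

theorem mul_mem_orderLocalSpan {N p q : ℕ} {F G : Equiv.Perm (Fin N) → ℝ}
    (hF : F ∈ orderLocalSpan N p) (hG : G ∈ orderLocalSpan N q) :
    F * G ∈ orderLocalSpan N (p + q) := by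
  classical
  have h := Submodule.mul_mem_mul hF hG
  rw [orderLocalSpan, orderLocalSpan, Submodule.span_mul_span] at h
  refine Submodule.span_mono ?_ h
  rintro _ ⟨F, ⟨U, hU, hF⟩, G, ⟨V, hV, hG⟩, rfl⟩
  refine ⟨U ∪ V, (Finset.card_union_le _ _).trans (add_le_add hU hV), fun π π' hπ => ?_⟩
  exact congrArg₂ (· * ·) (hF.mono Finset.subset_union_left π π' hπ)
    (hG.mono Finset.subset_union_right π π' hπ)

theorem prod_mem_orderLocalSpan {N q : ℕ} {ι : Type*} (s : Finset ι)
    (F : ι → Equiv.Perm (Fin N) → ℝ) (hF : ∀ i, F i ∈ orderLocalSpan N q) :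
    (fun π => ∏ i ∈ s, F i π) ∈ orderLocalSpan N (s.card * q) := by
  classical
  induction s using Finset.induction_on with
  | empty => simpa using const_mem_orderLocalSpan 1
  | insert i s hi ih =>
    simp only [Finset.prod_insert hi, Finset.card_insert_of_notMem hi]
    exact orderLocalSpan_mono (by ring_nf; rfl) (mul_mem_orderLocalSpan (hF i) ih)

theorem exists_polynomial_of_mem_orderLocalSpan {N q : ℕ} {F : Equiv.Perm (Fin N) → ℝ}
    (hF : F ∈ orderLocalSpan N q) (a : Fin N) :
    ∃ p : Polynomial ℝ, p.natDegree ≤ q ∧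
      ∀ r : Fin N, ∑ π : Equiv.Perm (Fin N) with π a = r, F π = p.eval ((r : ℕ) : ℝ) := by
  induction hF using Submodule.span_induction with
  | mem F hF =>
    obtain ⟨U, hU, hF⟩ := hF
    obtain ⟨p, hpd, hp⟩ := hF.exists_polynomial a
    exact ⟨p, hpd.trans hU, hp⟩
  | zero => exact ⟨0, by simp, by simp⟩
  | add F G _ _ hF hG =>
    obtain ⟨p, hpd, hp⟩ := hF
    obtain ⟨p', hpd', hp'⟩ := hG
    refine ⟨p + p', Polynomial.natDegree_add_le_of_degree_le hpd hpd', fun r => ?_⟩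
    simp [Finset.sum_add_distrib, hp, hp']
  | smul c F _ hF =>
    obtain ⟨p, hpd, hp⟩ := hF
    refine ⟨Polynomial.C c * p, (Polynomial.natDegree_C_mul_le _ _).trans hpd, fun r => ?_⟩
    simp [← Finset.mul_sum, hp]

/-- An order-local function that is nonnegative at every order in which `a` is not minimal has
nonnegative sum over all orders. -/
theorem sum_nonneg_of_mem_orderLocalSpan {N q : ℕ} {F : Equiv.Perm (Fin N) → ℝ}
    (hF : F ∈ orderLocalSpan N q) (hN : 2 * (q + 1) ^ 2 < N) (a : Fin N)
    (hpos : ∀ π : Equiv.Perm (Fin N), (π a : ℕ) ≠ 0 → 0 ≤ F π) : 0 ≤ ∑ π, F π := by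
  obtain ⟨p, hpd, hp⟩ := exists_polynomial_of_mem_orderLocalSpan hF a
  rw [← Finset.sum_fiberwise Finset.univ (fun π : Equiv.Perm (Fin N) => π a) F,
    Finset.sum_congr rfl fun r _ => hp r, Fin.sum_univ_eq_sum_range fun r => p.eval (r : ℝ),
    show N = N - 1 + 1 by omega]
  refine sum_range_eval_nonneg p q (N - 1) hpd (by omega) fun r h1 hr => ?_
  have := hp ⟨r, by omega⟩
  simp only at this
  rw [← this]
  refine Finset.sum_nonneg fun π hπ => hpos π ?_
  rw [(Finset.mem_filter.1 hπ).2]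
  exact Nat.one_le_iff_ne_zero.1 h1

/-! ### Decision trees and LOP solutions on linear orders -/

/-- The bits of the linear order `b ≺ c ↔ π b < π c`. -/
def orderInput {N : ℕ} (π : Equiv.Perm (Fin N)) (i : Fin (N * N)) : Bool :=
  decide (π (finProdFinEquiv.symm i).1 < π (finProdFinEquiv.symm i).2)

theorem orderInput_mem_orderLocalSpan {N : ℕ} (i : Fin (N * N)) (u v : ℝ) :
    (fun π => if orderInput π i = true then u else v) ∈ orderLocalSpan N 2 := by
  refine OrderLocal.mem_orderLocalSpan
    (U := {(finProdFinEquiv.symm i).1, (finProdFinEquiv.symm i).2}) (fun π π' hπ => ?_)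
    Finset.card_le_two
  have h : orderInput π i = orderInput π' i := decide_eq_decide.2
    (hπ (finProdFinEquiv.symm i).1 (by simp) (finProdFinEquiv.symm i).2 (by simp))
  simp only [h]

/-- Each query compares two elements, so every level of the tree adds at most two to the number of
elements inspected. -/
theorem DTree.eval_orderInput_mem_orderLocalSpan {N : ℕ} {α : Type} (T : DTree (N * N) α)
    (G : α → ℝ) : (fun π => G (T.eval (orderInput π))) ∈ orderLocalSpan N (2 * T.depth) := by
  induction T with
  | leaf a => exact const_mem_orderLocalSpan (G a)
  | query i t₀ t₁ h₀ h₁ =>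
    have h : (fun π => G ((DTree.query i t₀ t₁).eval (orderInput π))) =
        (fun π => if orderInput π i = true then 0 else 1) *
          (fun π => G (t₀.eval (orderInput π))) +
        (fun π => if orderInput π i = true then 1 else 0) *
          (fun π => G (t₁.eval (orderInput π))) := by
      funext π
      by_cases hi : orderInput π i = true <;> simp [DTree.eval, hi]
    rw [h]
    refine Submodule.add_mem _
      (orderLocalSpan_mono ?_ (mul_mem_orderLocalSpan (orderInput_mem_orderLocalSpan i _ _) h₀))
      (orderLocalSpan_mono ?_ (mul_mem_orderLocalSpan (orderInput_mem_orderLocalSpan i _ _) h₁))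
    · have := le_max_left t₀.depth t₁.depth
      simp only [DTree.depth]; omega
    · have := le_max_right t₀.depth t₁.depth
      simp only [DTree.depth]; omega

theorem DTDepthLE.mem_orderLocalSpan {N d : ℕ} {α : Type} {f : (Fin (N * N) → Bool) → α}
    (hf : DTDepthLE f d) (G : α → ℝ) :
    (fun π => G (f (orderInput π))) ∈ orderLocalSpan N (2 * d) := by
  obtain ⟨T, hT, hTf⟩ := hf
  simp only [← hTf]
  exact orderLocalSpan_mono (by omega) (T.eval_orderInput_mem_orderLocalSpan G)

theorem LOPOut.eq_minimal_of_isSolution {N : ℕ} (π : Equiv.Perm (Fin N)) (o : LOPOut N)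
    (h : (LOPOn N).Rel (orderInput π) o) : ∃ a, o = .minimal a ∧ (π a : ℕ) = 0 := by
  change o.IsSolution (fun a b => orderInput π (finProdFinEquiv (a, b))) at h
  cases o <;> simp only [LOPOut.IsSolution, orderInput, Equiv.symm_apply_apply,
    decide_eq_true_eq, decide_eq_false_iff_not] at h
  case minimal a =>
    refine ⟨a, rfl, ?_⟩
    by_contra h0
    have hb := h (π.symm ⟨0, (Nat.zero_le _).trans_lt (π a).2⟩)
    rw [Equiv.apply_symm_apply] at hb
    exact Nat.not_lt_zero _ (hb fun hb => h0 (by rw [← hb]; simp))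
  case irrefl a => exact absurd h (lt_irrefl _)
  case asymm a b => exact absurd h.2.1 h.2.2.not_gt
  case total a b =>
    exact absurd (π.injective (le_antisymm (not_lt.1 h.2.2) (not_lt.1 h.2.1))) h.1
  case trans a b c => exact absurd (h.2.2.2.1.trans h.2.2.2.2.1) h.2.2.2.2.2

/-! ### Polynomials at Boolean points -/

/-- The real point of a Boolean assignment. -/
def boolPoint {n : ℕ} (y : Fin n → Bool) (i : Fin n) : ℝ := if y i then 1 else 0

theorem eval_boolPoint_eq_zero {n : ℕ} (y : Fin n → Bool) {p : MvPolynomial (Fin n) ℝ}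
    (hp : p ∈ booleanIdeal n) : MvPolynomial.eval (boolPoint y) p = 0 := by
  have h : booleanIdeal n ≤ RingHom.ker (MvPolynomial.eval (boolPoint y)) := by
    refine Ideal.span_le.2 ?_
    rintro _ ⟨i, rfl⟩
    simp only [SetLike.mem_coe, RingHom.mem_ker, map_sub, map_pow, MvPolynomial.eval_X, boolPoint]
    split_ifs <;> norm_num
  exact h hp

namespace Conjunct

variable {n : ℕ}

theorem eval_poly (t : Conjunct n) (y : Fin n → Bool) :
    MvPolynomial.eval (boolPoint y) t.poly =
      (∏ i ∈ t.pos, if y i = true then 1 else 0) * ∏ i ∈ t.neg, if y i = true then 0 else 1 := by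
  simp only [poly, map_mul, map_prod, map_sub, map_one, MvPolynomial.eval_X, boolPoint]
  congr 1
  refine Finset.prod_congr rfl fun i _ => ?_
  split_ifs <;> norm_num

theorem eval_poly_nonneg (t : Conjunct n) (y : Fin n → Bool) :
    0 ≤ MvPolynomial.eval (boolPoint y) t.poly := by
  rw [eval_poly]
  refine mul_nonneg (Finset.prod_nonneg fun i _ => ?_) (Finset.prod_nonneg fun i _ => ?_) <;>
    split_ifs <;> norm_num

theorem eval_addPos (i : Fin n) (t : Conjunct n) (y : Fin n → Bool) :
    MvPolynomial.eval (boolPoint y) (addPos i t).poly =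
      if y i = true then MvPolynomial.eval (boolPoint y) t.poly else 0 := by
  rw [eval_poly, eval_poly]
  by_cases hi : i ∈ t.pos
  · simp only [addPos, Finset.insert_eq_of_mem hi]
    split_ifs with h
    · rfl
    · rw [Finset.prod_eq_zero hi (by simp [h]), zero_mul]
  · simp only [addPos, Finset.prod_insert hi]
    split_ifs <;> simp

theorem eval_addNeg (i : Fin n) (t : Conjunct n) (y : Fin n → Bool) :
    MvPolynomial.eval (boolPoint y) (addNeg i t).poly =
      if y i = true then 0 else MvPolynomial.eval (boolPoint y) t.poly := by
  rw [eval_poly, eval_poly]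
  by_cases hi : i ∈ t.neg
  · simp only [addNeg, Finset.insert_eq_of_mem hi]
    split_ifs with h
    · rw [Finset.prod_eq_zero (s := t.neg) hi (by simp [h]), mul_zero]
    · rfl
  · simp only [addNeg, Finset.prod_insert hi]
    split_ifs <;> simp

end Conjunct

namespace Conjuncts

variable {n : ℕ}

theorem eval_juntaPoly (D : Conjuncts n) (y : Fin n → Bool) :
    MvPolynomial.eval (boolPoint y) D.juntaPoly =
      (D.map fun t => MvPolynomial.eval (boolPoint y) t.poly).sum := by
  rw [juntaPoly, map_multiset_sum, Multiset.map_map]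
  rfl

theorem eval_juntaPoly_nonneg (D : Conjuncts n) (y : Fin n → Bool) :
    0 ≤ MvPolynomial.eval (boolPoint y) D.juntaPoly := by
  rw [eval_juntaPoly]
  refine Multiset.sum_nonneg fun v hv => ?_
  obtain ⟨t, -, rfl⟩ := Multiset.mem_map.1 hv
  exact t.eval_poly_nonneg y

theorem degree_le_of_mem {D : Conjuncts n} {t : Conjunct n} (ht : t ∈ D) :
    t.degree ≤ D.degree :=
  Multiset.le_sup (Multiset.mem_map_of_mem _ ht)

end Conjuncts

theorem DTree.eval_pathTerms {n : ℕ} (b : Bool) (T : DTree n Bool) (y : Fin n → Bool) :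
    MvPolynomial.eval (boolPoint y) (T.pathTerms b).juntaPoly =
      if T.eval y = b then 1 else 0 := by
  rw [Conjuncts.eval_juntaPoly]
  induction T with
  | leaf a =>
    by_cases h : a = b <;> simp [pathTerms, eval, h, Conjunct.eval_poly]
  | query i t₀ t₁ h₀ h₁ =>
    simp only [pathTerms, eval, Multiset.map_add, Multiset.map_map, Function.comp_def,
      Conjunct.eval_addNeg, Conjunct.eval_addPos, Multiset.sum_add]
    by_cases hi : y i = true
    · simpa [hi] using h₁
    · simpa [hi] using h₀

/-- Some witness rejects a non-solution, and the rejecting path followed by the input contributes a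
term equal to `1`, which pays for the `-1` in the axiom. -/
theorem Sigma2Presentation.eval_formula_nonneg {R : SearchProblem} (P : Sigma2Presentation R)
    (o : R.Out) (y : Fin R.bits → Bool) (h : ¬ R.Rel y o) :
    0 ≤ MvPolynomial.eval (boolPoint y) (P.formula o).dnfPoly := by
  rw [P.spec] at h
  push Not at h
  obtain ⟨z₀, hz₀⟩ := h
  have hsum : (P.formula o).juntaPoly = ∑ z, ((P.V o z).pathTerms false).juntaPoly := by
    simp only [Sigma2Presentation.formula, Conjuncts.juntaPoly]
    rw [← Multiset.coe_mapAddMonoidHom, map_sum, ← Multiset.coe_sumAddMonoidHom, map_sum]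
  rw [Conjuncts.dnfPoly, hsum, map_sub, map_sum, map_one, sub_nonneg]
  have h1 : (1 : ℝ) =
      MvPolynomial.eval (boolPoint y) ((P.V o z₀).pathTerms false).juntaPoly := by
    rw [DTree.eval_pathTerms, if_pos (by simpa using hz₀)]
  rw [h1]
  exact Finset.single_le_sum
    (f := fun z => MvPolynomial.eval (boolPoint y) ((P.V o z).pathTerms false).juntaPoly)
    (fun z _ => Conjuncts.eval_juntaPoly_nonneg _ y) (Finset.mem_univ z₀)

/-! ### Averaging the refutation over linear orders -/

theorem Conjunct.eval_mem_orderLocalSpan {N n d : ℕ} (f : Fin n → (Fin (N * N) → Bool) → Bool)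
    (hf : ∀ i, DTDepthLE (f i) d) (t : Conjunct n) :
    (fun π => MvPolynomial.eval (boolPoint fun i => f i (orderInput π)) t.poly) ∈
      orderLocalSpan N (t.degree * (2 * d)) := by
  simp only [Conjunct.eval_poly, Conjunct.degree, add_mul]
  exact mul_mem_orderLocalSpan
    (prod_mem_orderLocalSpan _ _ fun i => (hf i).mem_orderLocalSpan fun b => if b = true then 1 else 0)
    (prod_mem_orderLocalSpan _ _ fun i => (hf i).mem_orderLocalSpan fun b => if b = true then 0 else 1)

theorem Conjuncts.eval_juntaPoly_mem_orderLocalSpan {N n d k : ℕ}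
    (f : Fin n → (Fin (N * N) → Bool) → Bool) (hf : ∀ i, DTDepthLE (f i) d) (D : Conjuncts n)
    (hD : ∀ t ∈ D, t.degree ≤ k) :
    (fun π => MvPolynomial.eval (boolPoint fun i => f i (orderInput π)) D.juntaPoly) ∈
      orderLocalSpan N (k * (2 * d)) := by
  simp only [Conjuncts.eval_juntaPoly]
  induction D using Multiset.induction_on with
  | empty => simpa using const_mem_orderLocalSpan 0
  | cons t D ih =>
    simp only [Multiset.map_cons, Multiset.sum_cons]
    exact Submodule.add_mem _
      (orderLocalSpan_mono (Nat.mul_le_mul_right _ (hD t (Multiset.mem_cons_self _ _)))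
        (t.eval_mem_orderLocalSpan f hf))
      (ih fun t ht => hD t (Multiset.mem_cons_of_mem ht))

theorem Conjuncts.eval_dnfPoly_mem_orderLocalSpan {N n d : ℕ}
    (f : Fin n → (Fin (N * N) → Bool) → Bool) (hf : ∀ i, DTDepthLE (f i) d) (D : Conjuncts n) :
    (fun π => MvPolynomial.eval (boolPoint fun i => f i (orderInput π)) D.dnfPoly) ∈
      orderLocalSpan N (D.degree * (2 * d)) := by
  simp only [Conjuncts.dnfPoly, map_sub, map_one]
  exact Submodule.sub_mem _
    (D.eval_juntaPoly_mem_orderLocalSpan f hf fun t ht => Conjuncts.degree_le_of_mem ht)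
    (const_mem_orderLocalSpan 1)

/-- On average over all linear orders, the product of a low degree axiom and a low degree
conjunct is nonnegative after the substitution of a shallow formulation. -/
theorem Formulation.sum_dnfPoly_mul_conjunct_nonneg {N d k : ℕ} {R : SearchProblem}
    (P : Sigma2Presentation R) (φ : Formulation (LOPOn N) R) (hf : ∀ i, DTDepthLE (φ.f i) d)
    (hg : ∀ o, DTDepthLE (φ.g o) d) (hN : 2 * (2 * d * (k + 1) + 1) ^ 2 < N) (o : R.Out)
    (t : Conjunct R.bits) (hk : (P.formula o).degree + t.degree ≤ k) :
    0 ≤ ∑ π : Equiv.Perm (Fin N),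
      MvPolynomial.eval (boolPoint fun i => φ.f i (orderInput π)) (P.formula o).dnfPoly *
        MvPolynomial.eval (boolPoint fun i => φ.f i (orderInput π)) t.poly := by
  classical
  let H : Equiv.Perm (Fin N) → ℝ := fun π =>
    MvPolynomial.eval (boolPoint fun i => φ.f i (orderInput π)) (P.formula o).dnfPoly *
      MvPolynomial.eval (boolPoint fun i => φ.f i (orderInput π)) t.poly
  have hneg : ∀ π, H π < 0 → ∃ a, φ.g o (orderInput π) = .minimal a ∧ (π a : ℕ) = 0 := by
    intro π hπ
    refine LOPOut.eq_minimal_of_isSolution π _ (φ.correct _ o ?_)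
    by_contra hR
    exact hπ.not_ge (mul_nonneg (P.eval_formula_nonneg o _ hR) (t.eval_poly_nonneg _))
  -- Orders at which `g o` names no minimal element are dropped; `H` is nonnegative there.
  have hdecomp : ∀ π, ∑ a, H π * (if φ.g o (orderInput π) = .minimal a then 1 else 0) ≤ H π := by
    intro π
    by_cases h : ∃ a, φ.g o (orderInput π) = .minimal a
    · obtain ⟨a, ha⟩ := h
      rw [Finset.sum_eq_single a]
      · rw [if_pos ha, mul_one]
      · intro b _ hb
        rw [if_neg fun h => hb (LOPOut.minimal.inj (ha.symm.trans h)).symm, mul_zero]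
      · simp
    · push Not at h
      rw [Finset.sum_eq_zero fun a _ => by rw [if_neg (h a), mul_zero]]
      by_contra hlt
      obtain ⟨a, ha, -⟩ := hneg π (not_le.1 hlt)
      exact h a ha
  refine le_trans ?_ (Finset.sum_le_sum fun π _ => hdecomp π)
  rw [Finset.sum_comm]
  refine Finset.sum_nonneg fun a _ => ?_
  -- The axiom times the conjunct accounts for `2 * d * k` elements, and the indicator of the output
  -- of `g o` for a further `2 * d`.
  refine sum_nonneg_of_mem_orderLocalSpan (q := 2 * d * (k + 1)) ?_ hN a fun π hπ => ?_
  · refine orderLocalSpan_mono ?_ (mul_mem_orderLocalSpan (mul_mem_orderLocalSpan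
      ((P.formula o).eval_dnfPoly_mem_orderLocalSpan φ.f hf) (t.eval_mem_orderLocalSpan φ.f hf))
      ((hg o).mem_orderLocalSpan fun v => if v = LOPOut.minimal a then 1 else 0))
    rw [← add_mul, mul_add, mul_one, mul_comm (2 * d) k]
    exact Nat.add_le_add_right (Nat.mul_le_mul_right _ hk) _
  · split_ifs with h
    · rw [mul_one]
      by_contra hlt
      obtain ⟨b, hb, hb0⟩ := hneg π (not_le.1 hlt)
      rw [hb] at h
      injection h with h
      exact hπ (h ▸ hb0)
    · rw [mul_zero]

/-- Linear orders on `N` elements do not have shallow formulations by problems with low degree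
Sherali–Adams refutations. -/
theorem not_formulation_of_SARefutation {N d k : ℕ} {R : SearchProblem}
    (P : Sigma2Presentation R) (Q : SARefutation P.formula) (hQ : Q.DegreeLE k)
    (φ : Formulation (LOPOn N) R) (hf : ∀ i, DTDepthLE (φ.f i) d)
    (hg : ∀ o, DTDepthLE (φ.g o) d) : N ≤ 2 * (2 * d * (k + 1) + 1) ^ 2 := by
  by_contra! hN
  let y : Equiv.Perm (Fin N) → Fin R.bits → Bool := fun π i => φ.f i (orderInput π)
  have hid : ∀ π, ∑ o ∈ Q.S, MvPolynomial.eval (boolPoint (y π)) (P.formula o).dnfPoly *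
      MvPolynomial.eval (boolPoint (y π)) (Q.Jₐ o).juntaPoly +
      MvPolynomial.eval (boolPoint (y π)) Q.J.juntaPoly = -1 := by
    intro π
    have h := Q.identity
    rw [← map_one (Ideal.Quotient.mk (booleanIdeal R.bits)), ← map_neg, Ideal.Quotient.eq] at h
    have := eval_boolPoint_eq_zero (y π) h
    simp only [map_sub, map_add, map_sum, map_mul, map_neg, map_one] at this
    linarith
  have hsum : ∀ o ∈ Q.S, 0 ≤ ∑ π, MvPolynomial.eval (boolPoint (y π)) (P.formula o).dnfPoly *
      MvPolynomial.eval (boolPoint (y π)) (Q.Jₐ o).juntaPoly := by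
    intro o ho
    have hJ : ∀ t ∈ Q.Jₐ o, (P.formula o).degree + t.degree ≤ k := fun t ht =>
      (Nat.add_le_add_left (Conjuncts.degree_le_of_mem ht) _).trans (hQ.1 o ho)
    generalize Q.Jₐ o = J at hJ
    induction J using Multiset.induction_on with
    | empty => simp [Conjuncts.juntaPoly]
    | cons t J ih =>
      have hcons (π : Equiv.Perm (Fin N)) :
          MvPolynomial.eval (boolPoint (y π)) (Conjuncts.juntaPoly (t ::ₘ J)) =
          MvPolynomial.eval (boolPoint (y π)) t.poly +
            MvPolynomial.eval (boolPoint (y π)) (Conjuncts.juntaPoly J) := by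
        simp [Conjuncts.juntaPoly]
      simp only [hcons, mul_add, Finset.sum_add_distrib]
      exact add_nonneg (φ.sum_dnfPoly_mul_conjunct_nonneg P hf hg hN o t
        (hJ t (Multiset.mem_cons_self _ _))) (ih fun t ht => hJ t (Multiset.mem_cons_of_mem ht))
  -- Summing the pointwise identity gives minus the number of permutations on the right, against a
  -- nonnegative left side.
  have htot := Finset.sum_congr (rfl : (Finset.univ : Finset (Equiv.Perm (Fin N))) = _)
    fun π _ => hid π
  rw [Finset.sum_add_distrib, Finset.sum_comm, Finset.sum_const, Finset.card_univ] at htot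
  have h1 := Finset.sum_nonneg hsum
  have h2 : 0 ≤ ∑ π, MvPolynomial.eval (boolPoint (y π)) Q.J.juntaPoly :=
    Finset.sum_nonneg fun π _ => Conjuncts.eval_juntaPoly_nonneg _ _
  have h3 : (0 : ℝ) < Fintype.card (Equiv.Perm (Fin N)) := by exact_mod_cast Fintype.card_pos
  rw [nsmul_eq_mul] at htot
  linarith

/-! ### Polynomial growth and the conclusion -/

/-- `p` is bounded by a polynomial on the positive integers. -/
def PolyBounded (p : ℕ → ℕ) : Prop := ∃ C e : ℕ, ∀ n, 1 ≤ n → p n ≤ C * n ^ e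

namespace PolyBounded

theorem const (c : ℕ) : PolyBounded fun _ => c := ⟨c, 0, by simp⟩

theorem id : PolyBounded fun n => n := ⟨1, 1, by simp⟩

theorem add {p q : ℕ → ℕ} (hp : PolyBounded p) (hq : PolyBounded q) :
    PolyBounded fun n => p n + q n := by
  obtain ⟨C, e, hp⟩ := hp
  obtain ⟨C', e', hq⟩ := hq
  refine ⟨C + C', e + e', fun n hn => ?_⟩
  calc p n + q n ≤ C * n ^ e + C' * n ^ e' := add_le_add (hp n hn) (hq n hn)
    _ ≤ C * n ^ (e + e') + C' * n ^ (e + e') := by gcongr <;> omega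
    _ = _ := by ring

theorem mul {p q : ℕ → ℕ} (hp : PolyBounded p) (hq : PolyBounded q) :
    PolyBounded fun n => p n * q n := by
  obtain ⟨C, e, hp⟩ := hp
  obtain ⟨C', e', hq⟩ := hq
  refine ⟨C * C', e + e', fun n hn => ?_⟩
  calc p n * q n ≤ (C * n ^ e) * (C' * n ^ e') := Nat.mul_le_mul (hp n hn) (hq n hn)
    _ = _ := by ring

theorem pow {p : ℕ → ℕ} (hp : PolyBounded p) (k : ℕ) : PolyBounded fun n => p n ^ k := by
  induction k with
  | zero => simpa using const 1
  | succ k ih => simpa only [pow_succ] using ih.mul hp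

theorem exists_lt_two_pow {p : ℕ → ℕ} (hp : PolyBounded p) : ∃ n, p n < 2 ^ n := by
  obtain ⟨C, e, hp⟩ := hp
  have h := (tendsto_pow_const_div_const_pow_of_one_lt e (one_lt_two (α := ℝ))).eventually
    (gt_mem_nhds (show (0 : ℝ) < 1 / (C + 1) by positivity))
  obtain ⟨n, hn, hn1⟩ := (h.and (Filter.eventually_ge_atTop 1)).exists
  refine ⟨n, (hp n hn1).trans_lt ?_⟩
  rw [div_lt_div_iff₀ (by positivity) (by positivity)] at hn
  have h0 : (C : ℝ) * n ^ e < 2 ^ n := by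
    have : (0 : ℝ) ≤ (n : ℝ) ^ e := by positivity
    nlinarith
  exact_mod_cast h0

end PolyBounded

theorem mainTheorem4 (R : ℕ → SearchProblem) (P : ∀ n, Sigma2Presentation (R n))
    (hR : IsTFSigma2 R P) (hSA : HasPolylogSARefutation R P) :
    ¬ DTReduces LOP R := by
  rintro ⟨p, ⟨c, hp⟩, hred⟩
  obtain ⟨s, ⟨c', hs⟩, hSA⟩ := hSA
  -- `X n` bounds the complexity of the formulation, as the input of `LOP n` has `2^(2n)` bits. It
  -- therefore also bounds the logarithm of the input length of `R m`, so `K n` bounds the degree of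
  -- the refutation.
  let X : ℕ → ℕ := fun n => c * (2 * n) ^ c + c
  let K : ℕ → ℕ := fun n => c' * X n ^ c' + c'
  have hX : PolyBounded X :=
    ((PolyBounded.const c).mul (((PolyBounded.const 2).mul .id).pow c)).add (.const c)
  have hK : PolyBounded K := ((PolyBounded.const c').mul (hX.pow c')).add (.const c')
  obtain ⟨n, hn⟩ := ((PolyBounded.const 2).mul (((((PolyBounded.const 2).mul hX).mul
    (hK.add (.const 1))).add (.const 1)).pow 2)).exists_lt_two_pow
  obtain ⟨m, φ, d, hf, hg, hd⟩ := hred n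
  have hbits : Nat.log 2 (LOP n).bits = 2 * n := by
    change Nat.log 2 (2 ^ n * 2 ^ n) = 2 * n
    rw [← pow_add, Nat.log_pow one_lt_two, two_mul]
  have hpX : p (LOP n).bits ≤ X n := by simpa only [hbits] using hp (LOP n).bits
  have hlog : Nat.log 2 (R m).bits ≤ X n := by omega
  have hdX : d ≤ X n := by omega
  have hsK : s (R m).bits ≤ K n := (hs _).trans (by dsimp only [K]; gcongr)
  obtain ⟨Q, hQ⟩ := hSA m
  have h := not_formulation_of_SARefutation (P m) Q hQ φ hf hg
  refine (h.trans ?_).not_gt hn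
  gcongr
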